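/- Let $k$ be a field of characteristic zero, let $n\ge 1$, let $k[\mathbf x]=k[x_1,\dots,x_n]$ be the polynomial ring, and let $\Gamma$ be a totally ordered additive (abelian) group. For $\mathbf w=(w_1,\dots,w_n)\in\Gamma^n$ and $h\in k[\mathbf x]\setminus\{0\}$, let $\deg_{\mathbf w}h\in\Gamma$ be the maximum of $\sum_i a_iw_i$ over the monomials $x_1^{a_1}\cdots x_n^{a_n}$ that occur in $h$ (with $\deg_{\mathbf w}0=-\infty$), and let $h^{\mathbf w}$ be the sum of the terms of $h$ whose monomials attain this maximum. Let $f_1,\dots,f_n\in k[\mathbf x]$ be such that $k[f_1,\dots,f_n]=k[\mathbf x]$, and let $\mathbf w=(w_1,\dots,w_n)\in\Gamma^n$ with $w_i\ge 0$ for all $i$. Suppose that the field $k(f_1^{\mathbf w},\dots,f_n^{\mathbf w})$ has transcendence degree $n-1$ over $k$. Then the kernel of the $k$-algebra homomorphism $\lambda:k[\mathbf x]\to k[\mathbf x]$, $\lambda(x_i)=f_i^{\mathbf w}$, is a prime ideal of height one, it is generated by some $Q\in k[\mathbf x]\setminus\{0\}$, and the degree $$\Delta_{\mathbf f}^{\mathbf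 w}:=\deg_{\mathbf w_{\mathbf f}}Q,\qquad \mathbf w_{\mathbf f}=(\deg_{\mathbf w}f_1,\dots,\deg_{\mathbf w}f_n),$$ is the same for every generator $Q$ of $\ker\lambda$. Moreover, $$\sum_{i=1}^n\deg_{\mathbf w}f_i\ \ge\ \Delta_{\mathbf f}^{\mathbf w}+\sum_{i=1}^nw_i-\max\{w_i\mid i=1,\dots,n\}.$$ -/

import Mathlib

open MvPolynomial

noncomputable section

section

variable {k Γ : Type*} [Field k] [AddCommGroup Γ] [LinearOrder Γ] {n : ℕ}

/-- The initial form `f^w`: the component of `f` of the highest `w`-degree, where the `w`-degree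
of `f` is `weightedTotalDegree' w f : WithBot Γ`. By convention `0^w = 0`. -/
def initialForm (w : Fin n → Γ) (f : MvPolynomial (Fin n) k) : MvPolynomial (Fin n) k :=
  weightedHomogeneousComponent w ((weightedTotalDegree' w f).unbotD 0) f

/-- The homomorphism `λ_f^w : k[x] → k[x]` of `k`-algebras that sends `x_i` to `f_i^w`. -/
def initialHom (w : Fin n → Γ) (f : Fin n → MvPolynomial (Fin n) k) :
    MvPolynomial (Fin n) k →ₐ[k] MvPolynomial (Fin n) k :=
  aeval fun i => initialForm w (f i)

/-- The weight `w_f = (deg_w f_1, …, deg_w f_n)`, for `f_1, …, f_n` nonzero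
(the entry is `0` where `f_i = 0`). -/
def degreeWeight (w : Fin n → Γ) (f : Fin n → MvPolynomial (Fin n) k) : Fin n → Γ :=
  fun i => (weightedTotalDegree' w (f i)).unbotD 0

open Classical in
/-- `Δ_f^w`: the `w_f`-degree of a nonzero generator `Q` of the kernel of `λ_f^w`
(and `0` if there is no such generator). -/
def Delta (w : Fin n → Γ) (f : Fin n → MvPolynomial (Fin n) k) : Γ :=
  if h : ∃ Q : MvPolynomial (Fin n) k,
      Q ≠ 0 ∧ RingHom.ker (initialHom w f) = Ideal.span {Q} then
    (weightedTotalDegree' (degreeWeight w f) h.choose).unbotD 0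
  else 0

/-- The field `k(g_1, …, g_n)` generated by polynomials `g_1, …, g_n`, inside the field of
rational functions `k(x_1, …, x_n)`. -/
def rationalField (g : Fin n → MvPolynomial (Fin n) k) :
    IntermediateField k (FractionRing (MvPolynomial (Fin n) k)) :=
  IntermediateField.adjoin k
    (Set.range fun i => algebraMap _ (FractionRing (MvPolynomial (Fin n) k)) (g i))

end

end

-- Write `g i` for the leading form of `f i` and `δ i` for its degree. Since the transcendence
-- degree is `n - 1`, all but one of the `g i` can be taken algebraically independent, and Gauss's
-- lemma makes the ideal of relations `(Q)` with `Q` prime. Let `F` be the inverse substitution, so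
-- `F i` evaluated at `f` is `X i`.
--
-- The inequality compares two estimates (`exists_degree_relation_add_sum_sub_sum_le`). Some `F i`
-- has a `δ`-leading form `Q ^ m * R` with `m ≥ 1` and `Q ∤ R`; otherwise the `g i` would have
-- invertible Jacobian, which a nontrivial relation forbids. Choose `j` with `∂_j Q ≠ 0`. Modulo
-- `Q`, applying `∂_j` to this form `m` times gives `m! (∂_j Q) ^ m R`, which `Q` does not divide.
-- Hence `(∂_j ^ m F i)(f)` has degree at least `m Δ - m δ j`. Conversely, the Jacobian of `f` is a
-- nonzero constant, so each `∂_j` raises the degree after substitution by at most `∑ δ - δ j - ∑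
-- w`, starting from `w i`. Together, `m (Δ + ∑ w - ∑ δ) ≤ w i`, and `w i ≥ 0` allows dropping `m`.

-- Principality and height of the ideal of relations

attribute [local instance] Polynomial.algebra Polynomial.isLocalization in
/-- Over a unique factorization domain `R`, a nonzero prime ideal of `R[X]` that meets `R` only
in zero is principal. -/
theorem Polynomial.exists_eq_span_singleton_of_comap_C_eq_bot {R : Type*} [CommRing R] [IsDomain R]
    [UniqueFactorizationMonoid R] (P : Ideal (Polynomial R)) [hP : P.IsPrime] (hP0 : P ≠ ⊥)
    (hC : ∀ a : R, Polynomial.C a ∈ P → a = 0) : ∃ Q, Prime Q ∧ P = Ideal.span {Q} := by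
  obtain ⟨Q, hQP, hQ⟩ := hP.exists_mem_prime_of_ne_bot hP0
  refine ⟨Q, hQ, le_antisymm (fun g hg => ?_) ((Ideal.span_singleton_le_iff_mem _).2 hQP)⟩
  rw [Ideal.mem_span_singleton]
  let _ : NormalizedGCDMonoid R := Classical.choice inferInstance
  let K := FractionRing R
  have hdeg : Q.natDegree ≠ 0 := fun h => by
    rw [Polynomial.eq_C_of_natDegree_eq_zero h] at hQP
    have := hC _ hQP
    exact hQ.ne_zero (by rw [Polynomial.eq_C_of_natDegree_eq_zero h, this, map_zero])
  have hprim : Q.IsPrimitive := hQ.irreducible.isPrimitive hdeg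
  have hirr : Irreducible (Q.map (algebraMap R K)) :=
    (hprim.irreducible_iff_irreducible_map_fraction_map (K := K)).1 hQ.irreducible
  refine hprim.dvd_of_fraction_map_dvd_fraction_map (K := K) ?_
  -- If `Q ∤ g` over the fraction field, then `Q` and `g` are coprime there, so `P` extends to the
  -- unit ideal; but `P` contains no nonzero constant.
  by_contra hnd
  obtain ⟨a, b, hab⟩ := (hirr.coprime_iff_not_dvd).2 hnd
  have hdisj : Disjoint ((Submonoid.map Polynomial.C (nonZeroDivisors R) : Submonoid _) :
      Set (Polynomial R)) (P : Set (Polynomial R)) := by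
    rw [Set.disjoint_left]
    rintro _ ⟨r, hr, rfl⟩ h
    exact nonZeroDivisors.ne_zero hr (hC r h)
  refine (IsLocalization.map_algebraMap_ne_top_iff_disjoint
    (Submonoid.map Polynomial.C (nonZeroDivisors R)) (S := Polynomial K) P).2 hdisj ?_
  rw [Ideal.eq_top_iff_one, ← hab]
  exact Ideal.add_mem _ (Ideal.mul_mem_left _ _ (Ideal.mem_map_of_mem _ hQP))
    (Ideal.mul_mem_left _ _ (Ideal.mem_map_of_mem _ hg))

/-- If `g` is a family of elements of a domain such that all but one of them are algebraically
independent, but the whole family is not, then the ideal of relations of `g` is principal. -/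
theorem MvPolynomial.exists_ker_aeval_eq_span_singleton {k σ A : Type*} [Field k] [CommRing A]
    [IsDomain A] [Algebra k A] (g : σ → A) (j : σ)
    (hj : AlgebraicIndependent k fun i : {i // i ≠ j} => g i)
    (hg : ¬ AlgebraicIndependent k g) :
    ∃ Q : MvPolynomial σ k, Prime Q ∧
      RingHom.ker (aeval g : MvPolynomial σ k →ₐ[k] A) = Ideal.span {Q} := by
  classical
  let e : MvPolynomial σ k ≃ₐ[k] Polynomial (MvPolynomial {i // i ≠ j} k) :=
    (renameEquiv k (Equiv.optionSubtypeNe j).symm).trans (optionEquivLeft k _)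
  let P := RingHom.ker (aeval g : MvPolynomial σ k →ₐ[k] A)
  have hP : P.IsPrime := RingHom.ker_isPrime _
  have hP0 : P ≠ ⊥ := fun h => hg ((RingHom.injective_iff_ker_eq_bot _).2 h)
  let P' := P.comap e.symm.toRingEquiv.toRingHom
  have hP' : P'.IsPrime := Ideal.IsPrime.comap _
  have hP'0 : P' ≠ ⊥ := by
    intro h
    apply hP0
    rw [eq_bot_iff]
    intro x hx
    have : e x ∈ P' := by
      change e.symm (e x) ∈ P
      simpa using hx
    rw [h, Ideal.mem_bot] at this
    simpa using this
  have hC : ∀ p : MvPolynomial {i // i ≠ j} k, e.symm (Polynomial.C p) = rename (↑) p := by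
    intro p
    rw [AlgEquiv.symm_apply_eq]
    induction p using MvPolynomial.induction_on with
    | C a => simp [e]
    | add p q hp hq => simp [hp, hq]
    | mul_X p i hp => simp [hp, e, i.2]
  obtain ⟨Q, hQ, hPQ⟩ := Polynomial.exists_eq_span_singleton_of_comap_C_eq_bot P' hP'0 (by
    intro p hp
    change e.symm (Polynomial.C p) ∈ P at hp
    rw [hC] at hp
    change aeval g (rename _ p) = 0 at hp
    rw [aeval_rename] at hp
    exact (injective_iff_map_eq_zero _).1 hj p hp)
  refine ⟨e.symm Q, (MulEquiv.prime_iff e.symm.toMulEquiv).2 hQ, ?_⟩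
  ext x
  have : x ∈ P ↔ e x ∈ P' := by
    change _ ↔ e.symm (e x) ∈ P
    simp
  change x ∈ P ↔ _
  rw [this, hPQ, Ideal.mem_span_singleton, Ideal.mem_span_singleton,
    ← map_dvd_iff e.symm.toMulEquiv]
  simp

theorem Ideal.height_span_singleton_eq_one_of_prime {R : Type*} [CommRing R] [IsDomain R]
    [IsNoetherianRing R] {Q : R} (hQ : Prime Q) : (Ideal.span {Q}).height = 1 := by
  have hp : (Ideal.span {Q}).IsPrime := (Ideal.span_singleton_prime hQ.ne_zero).2 hQ
  refine le_antisymm ?_ ?_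
  · refine Ideal.height_le_one_of_isPrincipal_of_mem_minimalPrimes (Ideal.span {Q}) _ ?_
    rw [Ideal.minimalPrimes_eq_subsingleton_self]
    rfl
  · rw [Order.one_le_iff_ne_zero, Ne, Ideal.height_eq_zero_iff_eq_bot]
    simp [hQ.ne_zero]

/-! ### From transcendence degree to algebraic independence -/

/-- The field is algebraic over the algebra generated by the `g i`, so a transcendence basis can be
chosen among them; having `n - 1` elements, it leaves out exactly one index. -/
theorem exists_algebraicIndependent_of_trdeg_rationalField {k : Type*} [Field k] {n : ℕ} [NeZero n]
    (g : Fin n → MvPolynomial (Fin n) k)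
    (htr : Algebra.trdeg k (rationalField g) = ((n - 1 : ℕ) : Cardinal)) :
    ¬ AlgebraicIndependent k g ∧
      ∃ j : Fin n, AlgebraicIndependent k fun i : {i // i ≠ j} => g i := by
  classical
  let F := FractionRing (MvPolynomial (Fin n) k)
  let φ : MvPolynomial (Fin n) k →ₐ[k] F := Algebra.algHom k _ _
  have hφ : Function.Injective φ := IsFractionRing.injective (MvPolynomial (Fin n) k) F
  let ψ : rationalField g →ₐ[k] F := (rationalField g).val
  have hψ : Function.Injective ψ := Subtype.val_injective
  let g' : Fin n → rationalField g := fun i =>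
    ⟨algebraMap _ F (g i), IntermediateField.subset_adjoin _ _ ⟨i, rfl⟩⟩
  have hind : ∀ {ι : Type} (u : ι → Fin n),
      AlgebraicIndependent k (g ∘ u) ↔ AlgebraicIndependent k (g' ∘ u) := by
    intro ι u
    rw [← AlgHom.algebraicIndependent_iff φ hφ, ← AlgHom.algebraicIndependent_iff ψ hψ]
    rfl
  have halg : Algebra.IsAlgebraic (Algebra.adjoin k (Set.range g')) (rationalField g) := by
    refine ⟨fun x => ?_⟩
    obtain ⟨r, s, hrs⟩ := (IntermediateField.mem_adjoin_range_iff _ _ _).1 x.2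
    have key : ∀ p : MvPolynomial (Fin n) k,
        IsAlgebraic (Algebra.adjoin k (Set.range g')) (aeval g' p) := fun p => by
      have : aeval g' p ∈ Algebra.adjoin k (Set.range g') := by
        rw [Algebra.adjoin_range_eq_range_aeval]
        exact ⟨p, rfl⟩
      exact isAlgebraic_algebraMap
        (⟨_, this⟩ : Algebra.adjoin k (Set.range g'))
    have : x = aeval g' r * (aeval g' s)⁻¹ := by
      apply hψ
      rw [map_mul, map_inv₀, MvPolynomial.comp_aeval_apply, MvPolynomial.comp_aeval_apply,
        ← div_eq_mul_inv]
      exact hrs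
    rw [this]
    exact (key r).mul (key s).inv
  have hn : n ≠ 0 := NeZero.ne n
  constructor
  · intro h
    have h1 : AlgebraicIndependent k g' := (hind id).1 h
    have h2 := h1.lift_cardinalMk_le_trdeg
    rw [htr] at h2
    simp only [Cardinal.mk_fin, Cardinal.lift_natCast, Nat.cast_le] at h2
    omega
  · obtain ⟨t, hts, ht⟩ := exists_isTranscendenceBasis_subset (R := k) (Set.range g')
    have hcard := ht.cardinalMk_eq_trdeg
    rw [htr] at hcard
    have htfin : t.Finite := (Set.finite_range g').subset hts
    have htcard : t.ncard = n - 1 := by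
      rw [← Nat.card_coe_set_eq, Nat.card, hcard, Cardinal.toNat_natCast]
    choose u hu using fun x : t => hts x.2
    have huinj : Function.Injective u := fun a b h => Subtype.ext (by rw [← hu, ← hu, h])
    have : ∃ j, j ∉ Set.range u := by
      by_contra! hall
      have := Nat.card_eq_of_bijective u ⟨huinj, hall⟩
      rw [Nat.card_coe_set_eq, htcard, Nat.card_fin] at this
      omega
    obtain ⟨j, hj⟩ := this
    refine ⟨j, (hind _).2 ?_⟩
    have huj : ∀ x, u x ≠ j := fun x h => hj ⟨x, h⟩
    let v : t → {i // i ≠ j} := fun x => ⟨u x, huj x⟩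
    have hv : Function.Bijective v := by
      have : Finite t := htfin.to_subtype
      have : Fintype t := Fintype.ofFinite t
      rw [Fintype.bijective_iff_injective_and_card]
      refine ⟨fun a b h => huinj (congrArg Subtype.val h), ?_⟩
      rw [← Nat.card_eq_fintype_card, Nat.card_coe_set_eq, htcard]
      simp [Fintype.card_subtype_compl]
    let ev := Equiv.ofBijective v hv
    have := ht.1.comp ev.symm ev.symm.injective
    convert this using 1
    funext i
    obtain ⟨x, rfl⟩ := ev.surjective i
    simpa [ev, v] using hu x

namespace MvPolynomial

/-! ### Weighted degrees and leading forms -/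

section Degree

variable {R σ τ Γ : Type*} [CommRing R] [AddCommGroup Γ] [LinearOrder Γ]

theorem weightedTotalDegree'_le_coe_iff {w : σ → Γ} {p : MvPolynomial σ R} {d : Γ} :
    weightedTotalDegree' w p ≤ d ↔ ∀ s, coeff s p ≠ 0 → Finsupp.weight w s ≤ d := by
  simp [weightedTotalDegree', Finset.sup_le_iff]

theorem weightedTotalDegree'_sum_le {ι : Type*} {w : σ → Γ} {d : WithBot Γ} (s : Finset ι)
    {p : ι → MvPolynomial σ R} (h : ∀ i ∈ s, weightedTotalDegree' w (p i) ≤ d) :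
    weightedTotalDegree' w (∑ i ∈ s, p i) ≤ d := by
  classical
  refine Finset.sup_le fun m hm => ?_
  obtain ⟨i, hi, hmi⟩ := Finset.mem_biUnion.1 (support_sum hm)
  exact (Finset.le_sup (f := fun s => (Finsupp.weight w s : WithBot Γ)) hmi).trans (h i hi)

theorem weightedTotalDegree'_C_le (w : σ → Γ) (a : R) :
    weightedTotalDegree' w (C a) ≤ (0 : Γ) := by
  classical
  rw [weightedTotalDegree'_le_coe_iff]
  intro s hs
  rw [coeff_C] at hs
  have : s = 0 := by by_contra h; exact hs (if_neg (Ne.symm h))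
  simp [this]

theorem weightedTotalDegree'_C_mul [NoZeroDivisors R] (w : σ → Γ) {a : R} (ha : a ≠ 0)
    (p : MvPolynomial σ R) : weightedTotalDegree' w (C a * p) = weightedTotalDegree' w p := by
  have : (C a * p).support = p.support := by ext s; simp [coeff_C_mul, ha]
  rw [weightedTotalDegree', this, weightedTotalDegree']

theorem weightedHomogeneousComponent_eq_zero_of_lt {w : σ → Γ} {p : MvPolynomial σ R} {d : Γ}
    (h : weightedTotalDegree' w p < d) : weightedHomogeneousComponent w d p = 0 := by
  ext s
  rw [coeff_weightedHomogeneousComponent, coeff_zero]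
  split_ifs with hs
  · by_contra h0
    have := Finset.le_sup (f := fun s => (Finsupp.weight w s : WithBot Γ)) (mem_support_iff.2 h0)
    exact absurd (this.trans_lt h) (by simp [hs])
  · rfl

theorem le_weightedTotalDegree'_of_component_ne_zero {w : σ → Γ} {p : MvPolynomial σ R} {d : Γ}
    (h : weightedHomogeneousComponent w d p ≠ 0) : (d : WithBot Γ) ≤ weightedTotalDegree' w p := by
  by_contra hd
  exact h (weightedHomogeneousComponent_eq_zero_of_lt (not_le.1 hd))

theorem weightedHomogeneousComponent_ne_zero_of_eq {w : σ → Γ} {p : MvPolynomial σ R} {d : Γ}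
    (h : weightedTotalDegree' w p = d) : weightedHomogeneousComponent w d p ≠ 0 := by
  have hne : p.support.Nonempty := by
    rw [Finset.nonempty_iff_ne_empty]
    rintro h0
    simp [weightedTotalDegree', h0] at h
  obtain ⟨s, hs, hsd⟩ := Finset.exists_mem_eq_sup p.support hne
    (fun s => (Finsupp.weight w s : WithBot Γ))
  have : Finsupp.weight w s = d := by
    rw [← WithBot.coe_inj, ← h]
    exact hsd.symm
  intro h0
  have h1 := congrArg (coeff s) h0
  rw [coeff_weightedHomogeneousComponent, if_pos this, coeff_zero] at h1
  exact mem_support_iff.1 hs h1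

theorem weightedTotalDegree'_component_le (w : σ → Γ) (p : MvPolynomial σ R) (d : Γ) :
    weightedTotalDegree' w (weightedHomogeneousComponent w d p) ≤ d := by
  rw [weightedTotalDegree'_le_coe_iff]
  intro s hs
  rw [coeff_weightedHomogeneousComponent] at hs
  by_contra h
  exact hs (if_neg fun h' => h h'.le)

theorem weightedHomogeneousComponent_pderiv (w : σ → Γ) (p : MvPolynomial σ R) (d : Γ) (i : σ) :
    weightedHomogeneousComponent w (d - w i) (pderiv i p) =
      pderiv i (weightedHomogeneousComponent w d p) := by
  ext s
  rw [coeff_weightedHomogeneousComponent, coeff_pderiv, coeff_pderiv,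
    coeff_weightedHomogeneousComponent, map_add, Finsupp.weight_single, one_smul, ite_mul, zero_mul]
  exact if_congr eq_sub_iff_add_eq rfl rfl

theorem weightedHomogeneousComponent_iterate_pderiv (w : σ → Γ) (p : MvPolynomial σ R) (d : Γ)
    (i : σ) (m : ℕ) :
    weightedHomogeneousComponent w (d - m • w i) ((pderiv i)^[m] p) =
      (pderiv i)^[m] (weightedHomogeneousComponent w d p) := by
  induction m with
  | zero => simp
  | succ m ih =>
    rw [Function.iterate_succ_apply', Function.iterate_succ_apply', ← ih, succ_nsmul, ← sub_sub,
      weightedHomogeneousComponent_pderiv]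

theorem coe_unbotD_weightedTotalDegree' (w : σ → Γ) {p : MvPolynomial σ R} (hp : p ≠ 0) (a : Γ) :
    (((weightedTotalDegree' w p).unbotD a : Γ) : WithBot Γ) = weightedTotalDegree' w p := by
  obtain ⟨b, hb⟩ := WithBot.ne_bot_iff_exists.1 (mt (weightedTotalDegree'_eq_bot_iff w p).1 hp)
  rw [← hb, WithBot.unbotD_coe]

variable [IsOrderedAddMonoid Γ]

theorem weightedTotalDegree'_mul_le {w : σ → Γ} {p q : MvPolynomial σ R} {d e : Γ}
    (hp : weightedTotalDegree' w p ≤ d) (hq : weightedTotalDegree' w q ≤ e) :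
    weightedTotalDegree' w (p * q) ≤ (d + e : Γ) := by
  classical
  rw [weightedTotalDegree'_le_coe_iff] at *
  intro s hs
  rw [coeff_mul] at hs
  obtain ⟨⟨u, v⟩, huv, hne⟩ := Finset.exists_ne_zero_of_sum_ne_zero hs
  rw [← Finset.HasAntidiagonal.mem_antidiagonal.1 huv, map_add]
  exact add_le_add (hp u (left_ne_zero_of_mul hne)) (hq v (right_ne_zero_of_mul hne))

theorem weightedHomogeneousComponent_mul_of_le {w : σ → Γ} {p q : MvPolynomial σ R} {d e : Γ}
    (hp : weightedTotalDegree' w p ≤ d) (hq : weightedTotalDegree' w q ≤ e) :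
    weightedHomogeneousComponent w (d + e) (p * q) =
      weightedHomogeneousComponent w d p * weightedHomogeneousComponent w e q := by
  classical
  rw [weightedTotalDegree'_le_coe_iff] at *
  ext s
  rw [coeff_weightedHomogeneousComponent, coeff_mul, coeff_mul]
  trans ∑ x ∈ Finset.HasAntidiagonal.antidiagonal s,
    if Finsupp.weight w s = d + e then coeff x.1 p * coeff x.2 q else 0
  · split_ifs <;> simp
  refine Finset.sum_congr rfl ?_
  rintro ⟨u, v⟩ huv
  rw [coeff_weightedHomogeneousComponent, coeff_weightedHomogeneousComponent,
    ← Finset.HasAntidiagonal.mem_antidiagonal.1 huv, map_add]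
  simp only
  by_cases h0 : coeff u p = 0
  · simp [h0]
  by_cases h1 : coeff v q = 0
  · simp [h1]
  -- Both weights are bounded, so their sum attains `d + e` only if each attains its own bound.
  have hiff := add_eq_add_iff_eq_and_eq (hp u h0) (hq v h1)
  by_cases ha : Finsupp.weight w u = d <;> by_cases hb : Finsupp.weight w v = e <;>
    simp [hiff, ha, hb]

theorem weightedTotalDegree'_prod_le {ι : Type*} {w : σ → Γ} (s : Finset ι)
    {p : ι → MvPolynomial σ R} {d : ι → Γ} (h : ∀ i ∈ s, weightedTotalDegree' w (p i) ≤ d i) :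
    weightedTotalDegree' w (∏ i ∈ s, p i) ≤ (∑ i ∈ s, d i : Γ) := by
  classical
  induction s using Finset.induction_on with
  | empty => simpa using weightedTotalDegree'_C_le w (1 : R)
  | insert a s ha ih =>
    rw [Finset.prod_insert ha, Finset.sum_insert ha]
    exact weightedTotalDegree'_mul_le (h a (Finset.mem_insert_self _ _))
      (ih fun i hi => h i (Finset.mem_insert_of_mem hi))

theorem weightedHomogeneousComponent_prod_of_le {ι : Type*} {w : σ → Γ} (s : Finset ι)
    {p : ι → MvPolynomial σ R} {d : ι → Γ} (h : ∀ i ∈ s, weightedTotalDegree' w (p i) ≤ d i) :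
    weightedHomogeneousComponent w (∑ i ∈ s, d i) (∏ i ∈ s, p i) =
      ∏ i ∈ s, weightedHomogeneousComponent w (d i) (p i) := by
  classical
  induction s using Finset.induction_on with
  | empty => simpa using (isWeightedHomogeneous_one R w).weightedHomogeneousComponent_same
  | insert a s ha ih =>
    have hs : ∀ i ∈ s, weightedTotalDegree' w (p i) ≤ d i :=
      fun i hi => h i (Finset.mem_insert_of_mem hi)
    rw [Finset.prod_insert ha, Finset.sum_insert ha, Finset.prod_insert ha,
      weightedHomogeneousComponent_mul_of_le (h a (Finset.mem_insert_self _ _))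
        (weightedTotalDegree'_prod_le s hs), ih hs]

theorem weightedTotalDegree'_pow_le {w : σ → Γ} {p : MvPolynomial σ R} {d : Γ}
    (h : weightedTotalDegree' w p ≤ d) (m : ℕ) :
    weightedTotalDegree' w (p ^ m) ≤ (m • d : Γ) := by
  simpa using weightedTotalDegree'_prod_le (Finset.range m) (p := fun _ => p) (d := fun _ => d)
    (fun _ _ => h)

theorem weightedHomogeneousComponent_pow_of_le {w : σ → Γ} {p : MvPolynomial σ R} {d : Γ}
    (h : weightedTotalDegree' w p ≤ d) (m : ℕ) :
    weightedHomogeneousComponent w (m • d) (p ^ m) = weightedHomogeneousComponent w d p ^ m := by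
  simpa using weightedHomogeneousComponent_prod_of_le (Finset.range m) (p := fun _ => p)
    (d := fun _ => d) (fun _ _ => h)

section Substitution

variable {w : τ → Γ} {f : σ → MvPolynomial τ R} {δ : σ → Γ}

theorem weightedTotalDegree'_aeval_monomial_le (hf : ∀ i, weightedTotalDegree' w (f i) ≤ δ i)
    (s : σ →₀ ℕ) (a : R) :
    weightedTotalDegree' w (aeval f (monomial s a)) ≤ (Finsupp.weight δ s : Γ) := by
  rw [aeval_monomial, ← zero_add (Finsupp.weight δ s)]
  exact weightedTotalDegree'_mul_le (weightedTotalDegree'_C_le w a)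
    (weightedTotalDegree'_prod_le _ fun i _ => weightedTotalDegree'_pow_le (hf i) _)

theorem weightedHomogeneousComponent_aeval_monomial
    (hf : ∀ i, weightedTotalDegree' w (f i) ≤ δ i) (s : σ →₀ ℕ) (a : R) :
    weightedHomogeneousComponent w (Finsupp.weight δ s) (aeval f (monomial s a)) =
      aeval (fun i => weightedHomogeneousComponent w (δ i) (f i)) (monomial s a) := by
  rw [aeval_monomial, aeval_monomial, algebraMap_eq, weightedHomogeneousComponent_C_mul]
  congr 1
  refine (weightedHomogeneousComponent_prod_of_le (d := fun i => s i • δ i) s.support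
    fun i _ => weightedTotalDegree'_pow_le (hf i) _).trans ?_
  exact Finset.prod_congr rfl fun i _ => weightedHomogeneousComponent_pow_of_le (hf i) _

/-- Monomials of `δ`-weight below `e` stay below degree `e` after substitution. Upper bounds
suffice: when leading forms cancel, both sides are zero. -/
theorem weightedHomogeneousComponent_aeval_of_le
    (hf : ∀ i, weightedTotalDegree' w (f i) ≤ δ i)
    {P : MvPolynomial σ R} {e : Γ} (hP : weightedTotalDegree' δ P ≤ e) :
    weightedHomogeneousComponent w e (aeval f P) =
      aeval (fun i => weightedHomogeneousComponent w (δ i) (f i))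
        (weightedHomogeneousComponent δ e P) := by
  rw [weightedTotalDegree'_le_coe_iff] at hP
  conv_lhs => rw [P.as_sum]
  rw [weightedHomogeneousComponent_apply (w := δ), map_sum, map_sum, map_sum, Finset.sum_filter]
  refine Finset.sum_congr rfl fun s hs => ?_
  split_ifs with h
  · rw [← h, weightedHomogeneousComponent_aeval_monomial hf]
  · refine weightedHomogeneousComponent_eq_zero_of_lt
      ((weightedTotalDegree'_aeval_monomial_le hf s _).trans_lt (WithBot.coe_lt_coe.2 ?_))
    exact lt_of_le_of_ne (hP s (mem_support_iff.1 hs)) h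

end Substitution

theorem weightedTotalDegree'_pderiv_le {w : σ → Γ} {p : MvPolynomial σ R} {d : Γ}
    (hp : weightedTotalDegree' w p ≤ d) (i : σ) :
    weightedTotalDegree' w (pderiv i p) ≤ (d - w i : Γ) := by
  rw [weightedTotalDegree'_le_coe_iff] at *
  intro s hs
  rw [coeff_pderiv] at hs
  have := hp _ (left_ne_zero_of_mul hs)
  rw [map_add, Finsupp.weight_single, one_smul] at this
  exact le_sub_iff_add_le.2 this

theorem weightedTotalDegree'_iterate_pderiv_le {w : σ → Γ} {p : MvPolynomial σ R} {d : Γ}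
    (hp : weightedTotalDegree' w p ≤ d) (i : σ) (m : ℕ) :
    weightedTotalDegree' w ((pderiv i)^[m] p) ≤ (d - m • w i : Γ) := by
  induction m with
  | zero => simpa using hp
  | succ m ih =>
    rw [Function.iterate_succ_apply', succ_nsmul, ← sub_sub]
    exact weightedTotalDegree'_pderiv_le ih i

theorem weightedTotalDegree'_nonneg {w : σ → Γ} (hw : ∀ i, 0 ≤ w i) {p : MvPolynomial σ R}
    (hp : p ≠ 0) : ((0 : Γ) : WithBot Γ) ≤ weightedTotalDegree' w p := by
  obtain ⟨s, hs⟩ := support_nonempty.2 hp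
  refine le_trans (WithBot.coe_le_coe.2 ?_)
    (Finset.le_sup (f := fun s => (Finsupp.weight w s : WithBot Γ)) hs)
  rw [Finsupp.weight_apply]
  exact Finset.sum_nonneg fun i _ => nsmul_nonneg (hw i) _

end Degree

/-! ### Jacobian determinants -/

section Jacobian

variable {R σ τ : Type*} [CommRing R]

/-- The chain rule for partial derivatives of a substitution. -/
theorem pderiv_aeval [Fintype σ] (f : σ → MvPolynomial τ R) (P : MvPolynomial σ R) (j : τ) :
    pderiv j (aeval f P) = ∑ i, aeval f (pderiv i P) * pderiv j (f i) := by
  classical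
  induction P using MvPolynomial.induction_on with
  | C a => simp
  | add p q hp hq => simp only [map_add, hp, hq, add_mul, Finset.sum_add_distrib]
  | mul_X p a h =>
    simp only [map_mul, aeval_X, Derivation.leibniz, smul_eq_mul, h, pderiv_X, map_add, add_mul,
      Finset.sum_add_distrib, Finset.mul_sum]
    congr 1
    · rw [Finset.sum_eq_single a]
      · simp
      · intro b _ hb
        simp [hb.symm]
      · simp
    · exact Finset.sum_congr rfl fun i _ => by ring

variable {σ : Type*} [Fintype σ] [DecidableEq σ]

/-- The Jacobian matrix of a family of polynomials. -/
noncomputable def jacobianMatrix (f : σ → MvPolynomial σ R) : Matrix σ σ (MvPolynomial σ R) :=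
  Matrix.of fun i j => pderiv j (f i)

/-- By the chain rule the new row is a combination of the old rows, and only the multiple of row `j`
survives in the determinant. -/
theorem det_jacobianMatrix_update (f : σ → MvPolynomial σ R) (P : MvPolynomial σ R) (j : σ) :
    (jacobianMatrix (Function.update f j (aeval f P))).det =
      aeval f (pderiv j P) * (jacobianMatrix f).det := by
  have : jacobianMatrix (Function.update f j (aeval f P)) =
      (jacobianMatrix f).updateRow j (∑ i, aeval f (pderiv i P) • jacobianMatrix f i) := by
    ext1 a b
    by_cases h : a = j
    · subst h
      simpa [jacobianMatrix, -aeval_eq_bind₁] using pderiv_aeval f P b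
    · simp [jacobianMatrix, h]
  rw [this, Matrix.det_updateRow_sum, smul_eq_mul]

theorem isUnit_det_jacobianMatrix_of_aeval_eq_X {f F : σ → MvPolynomial σ R}
    (h : ∀ i, aeval f (F i) = X i) : IsUnit (jacobianMatrix f).det := by
  have : (jacobianMatrix F).map (aeval f) * jacobianMatrix f = 1 := by
    ext1 i j
    rw [Matrix.mul_apply, Matrix.one_apply]
    have := pderiv_aeval f (F i) j
    rw [h, pderiv_X, Pi.single_apply] at this
    exact this.symm
  exact Matrix.isUnit_det_of_left_inverse this

/-- Every term of the Leibniz expansion obeys the same bound, because permuting the rows does not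
change `∑ i, d i`. -/
theorem weightedTotalDegree'_det_jacobianMatrix_le {Γ : Type*} [AddCommGroup Γ] [LinearOrder Γ]
    [IsOrderedAddMonoid Γ] {w : σ → Γ} {f : σ → MvPolynomial σ R} {d : σ → Γ}
    (h : ∀ i, weightedTotalDegree' w (f i) ≤ d i) :
    weightedTotalDegree' w (jacobianMatrix f).det ≤ (∑ i, d i - ∑ i, w i : Γ) := by
  rw [Matrix.det_apply']
  refine weightedTotalDegree'_sum_le _ fun s _ => ?_
  have h1 : weightedTotalDegree' w (∏ i, jacobianMatrix f (s i) i) ≤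
      (∑ i, (d (s i) - w i) : Γ) :=
    weightedTotalDegree'_prod_le _ fun i _ => weightedTotalDegree'_pderiv_le (h (s i)) i
  rw [Finset.sum_sub_distrib, Equiv.sum_comp s d] at h1
  have h2 := weightedTotalDegree'_mul_le
    (weightedTotalDegree'_C_le (R := R) w ((Equiv.Perm.sign s : ℤ) : R)) h1
  simpa using h2

end Jacobian

end MvPolynomial

/-! ### Iterated derivatives and the degree estimate -/

/-- Modulo `q`, only the terms in which each of the `m` factors `q` is differentiated once survive.
-/
theorem Derivation.dvd_iterate_pow_mul_sub {k A : Type*} [CommRing k] [CommRing A] [Algebra k A]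
    (D : Derivation k A A) (q : A) (m : ℕ) (r : A) :
    q ∣ D^[m] (q ^ m * r) - (m.factorial : A) * D q ^ m * r := by
  induction m generalizing r with
  | zero => simp
  | succ m ih =>
    have h1 : D (q ^ (m + 1) * r) = q ^ m * ((m + 1) * D q * r + q * D r) := by
      rw [D.leibniz, D.leibniz_pow]
      simp only [smul_eq_mul, nsmul_eq_mul, Nat.add_sub_cancel]
      push_cast
      ring
    rw [Function.iterate_succ_apply, h1, Nat.factorial_succ]
    obtain ⟨c, hc⟩ := ih ((m + 1) * D q * r + q * D r)
    refine ⟨c + m.factorial * D q ^ m * D r, ?_⟩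
    rw [sub_eq_iff_eq_add] at hc
    rw [hc]
    push_cast
    ring

namespace MvPolynomial

variable {k σ : Type*} [Field k]

/-- A nonzero partial derivative has strictly smaller total degree. -/
theorem not_dvd_pderiv {Q : MvPolynomial σ k} {j : σ} (h : pderiv j Q ≠ 0) : ¬ Q ∣ pderiv j Q := by
  rintro ⟨c, hc⟩
  have hQ : Q ≠ 0 := by rintro rfl; simp at h
  have hc0 : c ≠ 0 := by rintro rfl; simp [hc] at h
  have h1 : totalDegree Q ≤ totalDegree (pderiv j Q) := by
    rw [hc, totalDegree_mul_of_isDomain hQ hc0]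
    exact Nat.le_add_right _ _
  obtain ⟨s, hs, hsd⟩ := Finset.exists_mem_eq_sup _ (support_nonempty.2 h)
    (fun s : σ →₀ ℕ => s.sum fun _ e => e)
  have h2 : coeff (s + Finsupp.single j 1) Q ≠ 0 := by
    rw [mem_support_iff, coeff_pderiv] at hs
    exact left_ne_zero_of_mul hs
  have h3 := le_totalDegree (mem_support_iff.2 h2)
  rw [Finsupp.sum_add_index' (fun _ => rfl) (fun _ _ _ => rfl), Finsupp.sum_single_index rfl] at h3
  have h4 : totalDegree (pderiv j Q) = s.sum fun _ e => e := hsd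
  omega

theorem exists_pderiv_ne_zero [CharZero k] {Q : MvPolynomial σ k} (hQ : Q ≠ 0)
    (hu : ¬ IsUnit Q) : ∃ j, pderiv j Q ≠ 0 := by
  classical
  by_contra! h
  have hC : Q = C (coeff 0 Q) := by
    ext s
    rw [coeff_C]
    split_ifs with hs
    · rw [hs]
    · obtain ⟨j, hj⟩ := Finsupp.ne_iff.1 (Ne.symm hs)
      have h1 := congrArg (coeff (s - Finsupp.single j 1)) (h j)
      rw [coeff_pderiv, coeff_zero, Finsupp.sub_add_single_one_cancel hj] at h1
      exact (mul_eq_zero.1 h1).resolve_right (Nat.cast_add_one_ne_zero _)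
  rw [hC] at hu hQ
  exact hu ((isUnit_iff_ne_zero.2 fun h0 => hQ (by rw [h0, C_0])).map C)

variable {Γ : Type*} [AddCommGroup Γ] [LinearOrder Γ] [IsOrderedAddMonoid Γ]
  [Fintype σ] {f F : σ → MvPolynomial σ k}

/-- Substituting the polynomials `f i` with invertible Jacobian into a partial derivative of `P`
raises the degree at most by the amount by which it would raise the degree of the form
`∏ i ≠ j, df i` relative to `∏ i, dx i`. -/
theorem weightedTotalDegree'_aeval_pderiv_le (hF : ∀ i, aeval f (F i) = X i) {w : σ → Γ}
    {δ : σ → Γ} (hδ : ∀ i, weightedTotalDegree' w (f i) ≤ δ i) {P : MvPolynomial σ k} {e : Γ}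
    (hP : weightedTotalDegree' w (aeval f P) ≤ e) (j : σ) :
    weightedTotalDegree' w (aeval f (pderiv j P)) ≤ (e + (∑ i, δ i - δ j - ∑ i, w i) : Γ) := by
  classical
  obtain ⟨c, hc, hdet⟩ := isUnit_iff_eq_C_of_isReduced.1 (isUnit_det_jacobianMatrix_of_aeval_eq_X hF)
  -- Replacing `f j` by `aeval f P` multiplies the constant Jacobian by `aeval f (pderiv j P)`, so
  -- bounding the new determinant bounds that factor.
  have h := weightedTotalDegree'_det_jacobianMatrix_le (w := w)
    (f := Function.update f j (aeval f P)) (d := Function.update δ j e) (fun i => by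
      by_cases hi : i = j
      · subst hi; simpa only [Function.update_self] using hP
      · simpa only [Function.update_of_ne hi] using hδ i)
  rw [det_jacobianMatrix_update, hdet, mul_comm, weightedTotalDegree'_C_mul w hc.ne_zero,
    Finset.sum_update_of_mem (Finset.mem_univ j)] at h
  rw [Finset.sdiff_singleton_eq_erase, Finset.sum_erase_eq_sub (Finset.mem_univ j), add_sub_assoc] at h
  exact h

theorem weightedTotalDegree'_aeval_iterate_pderiv_le (hF : ∀ i, aeval f (F i) = X i) {w : σ → Γ}
    {δ : σ → Γ} (hδ : ∀ i, weightedTotalDegree' w (f i) ≤ δ i) {P : MvPolynomial σ k} {e : Γ}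
    (hP : weightedTotalDegree' w (aeval f P) ≤ e) (j : σ) (m : ℕ) :
    weightedTotalDegree' w (aeval f ((pderiv j)^[m] P)) ≤
      (e + m • (∑ i, δ i - δ j - ∑ i, w i) : Γ) := by
  induction m with
  | zero => simpa only [Function.iterate_zero, id, zero_nsmul, add_zero] using hP
  | succ m ih =>
    rw [Function.iterate_succ_apply', succ_nsmul, ← add_assoc]
    exact weightedTotalDegree'_aeval_pderiv_le hF hδ ih j

theorem exists_degree_relation_add_sum_sub_sum_le [CharZero k] (hF : ∀ i, aeval f (F i) = X i)
    {w : σ → Γ} (hw : ∀ i, 0 ≤ w i) {δ : σ → Γ} (hδ : ∀ i, weightedTotalDegree' w (f i) = δ i)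
    {Q : MvPolynomial σ k} (hQ : Prime Q)
    (hker : RingHom.ker (aeval fun i => weightedHomogeneousComponent w (δ i) (f i) :
      MvPolynomial σ k →ₐ[k] MvPolynomial σ k) = Ideal.span {Q})
    {Δ : Γ} (hΔ : weightedTotalDegree' δ Q = Δ) :
    ∃ i, Δ + ∑ i, w i - ∑ i, δ i ≤ w i := by
  classical
  set g := fun i => weightedHomogeneousComponent w (δ i) (f i) with hg
  have hmem : ∀ P, aeval g P = 0 ↔ Q ∣ P := fun P => by
    rw [← Ideal.mem_span_singleton, ← hker]; rfl
  have hδ' : ∀ i, weightedTotalDegree' w (f i) ≤ δ i := fun i => (hδ i).le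
  have hδ0 : ∀ i, 0 ≤ δ i := fun i => by
    rw [← WithBot.coe_le_coe, ← hδ i]
    refine weightedTotalDegree'_nonneg hw fun h => ?_
    have := hδ i
    rw [h, weightedTotalDegree'_zero] at this
    exact WithBot.bot_ne_coe this
  obtain ⟨j, hj⟩ := exists_pderiv_ne_zero hQ.ne_zero hQ.not_isUnit
  have hjQ := not_dvd_pderiv hj
  have hF0 : ∀ i, F i ≠ 0 := fun i h => by
    have := hF i
    rw [h, map_zero] at this
    exact X_ne_zero i this.symm
  choose d hd using fun i =>
    WithBot.ne_bot_iff_exists.1 (mt (weightedTotalDegree'_eq_bot_iff δ (F i)).1 (hF0 i))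
  have hd' : ∀ i, weightedTotalDegree' δ (F i) ≤ d i := fun i => (hd i).ge
  have hX : ∀ i, weightedTotalDegree' w (X i : MvPolynomial σ k) ≤ w i := fun i => by
    rw [weightedTotalDegree'_le_coe_iff]
    intro s hs
    rw [coeff_X] at hs
    have : Finsupp.single i 1 = s := by by_contra h; exact hs (if_neg h)
    rw [← this, Finsupp.weight_single, one_smul]
  -- Some inverse component has a leading form that is divisible by `Q`.
  obtain ⟨i, hi⟩ : ∃ i, Q ∣ weightedHomogeneousComponent δ (d i) (F i) := by
    by_contra! hall
    have hsurj : ∀ i, aeval g (weightedHomogeneousComponent δ (d i) (F i)) = X i := fun i => by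
      have h1 := weightedHomogeneousComponent_aeval_of_le hδ' (hd' i)
      have h2 : weightedHomogeneousComponent w (d i) (aeval f (F i)) ≠ 0 := by
        rw [h1]
        exact fun h => hall i ((hmem _).1 h)
      rw [hF, weightedHomogeneousComponent_of_mem (isWeightedHomogeneous_X k w i)] at h1 h2
      -- A homogeneous component of `X i` is `0` or `X i`, and here it is nonzero.
      rw [if_pos (by by_contra h; exact h2 (if_neg h))] at h1
      exact h1.symm
    have hunit := isUnit_det_jacobianMatrix_of_aeval_eq_X hsurj
    -- Substituting the relation `Q` for `g j` creates a zero row, forcing `aeval g (pderiv j Q) =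
    -- 0`.
    have h := det_jacobianMatrix_update g Q j
    rw [(hmem Q).2 dvd_rfl] at h
    have h0 : (jacobianMatrix (Function.update g j 0)).det = 0 :=
      Matrix.det_eq_zero_of_row_eq_zero j fun i => by simp [jacobianMatrix]
    rw [h0] at h
    exact hjQ ((hmem _).1 ((mul_eq_zero.1 h.symm).resolve_right hunit.ne_zero))
  refine ⟨i, ?_⟩
  set H := weightedHomogeneousComponent δ (d i) (F i) with hH
  have hH0 : H ≠ 0 := weightedHomogeneousComponent_ne_zero_of_eq (hd i).symm
  obtain ⟨m, R, hR, hHR⟩ := (FiniteMultiplicity.of_prime_left hQ hH0).exists_eq_pow_mul_and_not_dvd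
    |> fun ⟨R, h1, h2⟩ => (⟨_, R, h2, h1⟩ : ∃ m R, ¬ Q ∣ R ∧ H = Q ^ m * R)
  have hm : m ≠ 0 := by
    rintro rfl
    rw [pow_zero, one_mul] at hHR
    exact hR (hHR ▸ hi)
  have hR0 : R ≠ 0 := fun h => hR (h ▸ dvd_zero Q)
  -- The degree of the leading form is at least `m • Δ`.
  have hmd : m • Δ ≤ d i := by
    obtain ⟨ρ, hρ⟩ := WithBot.ne_bot_iff_exists.1 (mt (weightedTotalDegree'_eq_bot_iff δ R).1 hR0)
    have hρ0 : 0 ≤ ρ := by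
      rw [← WithBot.coe_le_coe, hρ]
      exact weightedTotalDegree'_nonneg hδ0 hR0
    have h1 : weightedHomogeneousComponent δ (m • Δ + ρ) H ≠ 0 := by
      rw [hHR, weightedHomogeneousComponent_mul_of_le (weightedTotalDegree'_pow_le hΔ.le m) hρ.ge,
        weightedHomogeneousComponent_pow_of_le hΔ.le]
      exact mul_ne_zero (pow_ne_zero _ (weightedHomogeneousComponent_ne_zero_of_eq hΔ))
        (weightedHomogeneousComponent_ne_zero_of_eq hρ.symm)
    have h2 := WithBot.coe_le_coe.1 ((le_weightedTotalDegree'_of_component_ne_zero h1).trans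
      (weightedTotalDegree'_component_le δ (F i) (d i)))
    exact (le_add_of_nonneg_right hρ0).trans h2
  -- The `m`-th derivative of `F i` keeps its expected degree after the substitution.
  have hlow : ((d i - m • δ j : Γ) : WithBot Γ) ≤
      weightedTotalDegree' w (aeval f ((pderiv j)^[m] (F i))) := by
    apply le_weightedTotalDegree'_of_component_ne_zero
    rw [weightedHomogeneousComponent_aeval_of_le hδ'
      (weightedTotalDegree'_iterate_pderiv_le (hd' i) j m),
      weightedHomogeneousComponent_iterate_pderiv, ← hH, Ne, hmem, hHR]
    intro hdvd
    -- If the leading component were killed, the prime `Q` would divide `m! (∂_j Q) ^ m R`;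
    -- characteristic zero makes `m!` a unit.
    have h1 := (dvd_sub_right hdvd).1 ((pderiv j).dvd_iterate_pow_mul_sub Q m R)
    rcases hQ.dvd_or_dvd h1 with h2 | h2
    · rcases hQ.dvd_or_dvd h2 with h3 | h3
      · refine hQ.not_isUnit (isUnit_of_dvd_unit h3 ?_)
        have : (m.factorial : MvPolynomial σ k) = C (m.factorial : k) := by simp
        rw [this]
        exact (isUnit_iff_ne_zero.2 (by exact_mod_cast m.factorial_ne_zero)).map C
      · exact hjQ (hQ.dvd_of_dvd_pow h3)
    · exact hR h2
  have hup := weightedTotalDegree'_aeval_iterate_pderiv_le hF hδ' (P := F i) (e := w i)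
    (by rw [hF]; exact hX i) j m
  have hle := WithBot.coe_le_coe.1 (hlow.trans hup)
  have hfin : m • (Δ + ∑ i, w i - ∑ i, δ i) ≤ w i := by
    have h1 : m • Δ - m • δ j ≤ w i + m • (∑ i, δ i - δ j - ∑ i, w i) :=
      (sub_le_sub_right hmd _).trans hle
    have h2 : m • (Δ + ∑ i, w i - ∑ i, δ i) =
        m • Δ - m • δ j - m • (∑ i, δ i - δ j - ∑ i, w i) := by
      rw [← nsmul_sub, ← nsmul_sub]
      congr 1
      abel
    rw [h2, sub_le_iff_le_add]
    exact h1
  rcases le_total (Δ + ∑ i, w i - ∑ i, δ i) 0 with h | h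
  · exact h.trans (hw i)
  · refine le_trans ?_ hfin
    simpa using nsmul_le_nsmul_left h (Nat.one_le_iff_ne_zero.2 hm)

end MvPolynomial

/-! ### The main theorem -/

theorem mainTheorem4 {k Γ : Type*} [Field k] [CharZero k]
    [AddCommGroup Γ] [LinearOrder Γ] [IsOrderedAddMonoid Γ]
    {n : ℕ} [NeZero n]
    (f : Fin n → MvPolynomial (Fin n) k)
    (hf : Algebra.adjoin k (Set.range f) = ⊤)
    (w : Fin n → Γ) (hw : ∀ i, 0 ≤ w i)
    (htr : Algebra.trdeg k (rationalField fun i => initialForm w (f i)) = ((n - 1 : ℕ) : Cardinal)) :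
    -- the kernel of `λ_f^w` is a height-one prime with a nonzero generator,
    -- and every generator has `w_f`-degree `Δ_f^w`
    (RingHom.ker (initialHom w f)).IsPrime ∧
    (RingHom.ker (initialHom w f)).height = 1 ∧
    (∃ Q : MvPolynomial (Fin n) k,
      Q ≠ 0 ∧ RingHom.ker (initialHom w f) = Ideal.span {Q}) ∧
    (∀ Q : MvPolynomial (Fin n) k, RingHom.ker (initialHom w f) = Ideal.span {Q} →
      weightedTotalDegree' (degreeWeight w f) Q = ((Delta w f : Γ) : WithBot Γ)) ∧
    -- the inequality
    ((Delta w f + ∑ i, w i - Finset.univ.sup' Finset.univ_nonempty w : Γ) : WithBot Γ) ≤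
      ∑ i, weightedTotalDegree' w (f i) := by
  obtain ⟨hdep, j, hj⟩ :=
    exists_algebraicIndependent_of_trdeg_rationalField (fun i => initialForm w (f i)) htr
  obtain ⟨Q, hQ, hker⟩ :=
    exists_ker_aeval_eq_span_singleton (fun i => initialForm w (f i)) j hj hdep
  change RingHom.ker (initialHom w f) = Ideal.span {Q} at hker
  have hex : ∃ Q : MvPolynomial (Fin n) k,
      Q ≠ 0 ∧ RingHom.ker (initialHom w f) = Ideal.span {Q} := ⟨Q, hQ.ne_zero, hker⟩
  have hDelta : ∀ P : MvPolynomial (Fin n) k, RingHom.ker (initialHom w f) = Ideal.span {P} →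
      weightedTotalDegree' (degreeWeight w f) P = ((Delta w f : Γ) : WithBot Γ) := by
    intro P hP
    obtain ⟨hne, hspan⟩ := hex.choose_spec
    rw [Delta, dif_pos hex, coe_unbotD_weightedTotalDegree' _ hne]
    -- Two generators differ by a unit, that is, a nonzero constant, which does not affect the
    -- degree.
    obtain ⟨u, hu⟩ := Ideal.span_singleton_eq_span_singleton.1 (hspan.symm.trans hP)
    obtain ⟨c, hc, huc⟩ := isUnit_iff_eq_C_of_isReduced.1 u.isUnit
    rw [← hu, huc, mul_comm, weightedTotalDegree'_C_mul _ hc.ne_zero]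
  refine ⟨RingHom.ker_isPrime _, ?_, hex, hDelta, ?_⟩
  · rw [hker]
    exact Ideal.height_span_singleton_eq_one_of_prime hQ
  have hX : ∀ i, ∃ G, aeval f G = X i := fun i => by
    have : (X i : MvPolynomial (Fin n) k) ∈ Algebra.adjoin k (Set.range f) := hf ▸ Algebra.mem_top
    rw [Algebra.adjoin_range_eq_range_aeval] at this
    exact this
  choose F hF using hX
  -- A zero `f i` would give the invertible Jacobian matrix a zero row; hence the default `0` in
  -- `degreeWeight` never occurs.
  have hf0 : ∀ i, f i ≠ 0 := fun i h => by
    refine (isUnit_det_jacobianMatrix_of_aeval_eq_X hF).ne_zero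
      (Matrix.det_eq_zero_of_row_eq_zero i fun l => ?_)
    simp [jacobianMatrix, h]
  have hδ : ∀ i, weightedTotalDegree' w (f i) = degreeWeight w f i := fun i =>
    (coe_unbotD_weightedTotalDegree' w (hf0 i) 0).symm
  obtain ⟨i, hi⟩ := exists_degree_relation_add_sum_sub_sum_le hF hw hδ hQ hker (hDelta Q hker)
  rw [Finset.sum_congr rfl fun i _ => hδ i, ← WithBot.coe_sum, WithBot.coe_le_coe,
    sub_le_comm]
  exact hi.trans (Finset.le_sup' w (Finset.mem_univ i))
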